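/- All rings are associative and unital. All topological rings are assumed complete, separated and right linear (open right ideals form a base of neighborhoods of zero). A topological ring $R$ is *topologically semiperfect* if there is a zero-convergent family $(e_z)_{z\in Z}$ of pairwise orthogonal idempotents of $R$ such that $\sum_{z\in Z} e_z=1$ (the limit of the finite partial sums) and every ring $e_zRe_z$ is local. The *topological Jacobson radical* $\mathfrak H(R)$ is the intersection of all open maximal right ideals of $R$; it is a two-sided ideal. A subgroup $H$ of a topological abelian group $A$ (with a base of neighborhoods of zero consisting of open subgroups) is *strongly closed* if it is closed, $A/H$ is complete in the quotient topology, and every zero-convergent family of elements of $A/H$ (with any index set) lifts to a zero-convergent family in $A$. A right module is *discrete* if the annihilator of each of its elements is open, and a topological ring $S$ is *topologically semisimple* if every submodule of every discrete right $S$-module is a direct summand. **Theorem.** (1) Let $R$ be a topologically semiperfect topological ring and $\mathfrak H=\mathfrak H(R)$. Then (a) $\mathfrak H$ is strongly closed in $R$; (b) the ring $R/\mathfrak H$ with the quotient topology is a (complete, separated, right linear) topologically semisimple topological ring. (2) Let $A$ be a ring, $(M_z)_{z\in Z}$ a family of left $A$-modules with local endomorphism rings, $M=\bigoplus_{z\in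 Z}M_z$, and let $R=\operatorname{End}_A(M)^{\mathrm{op}}$ carry the finite topology, in which the annihilators of the finite subsets of $M$ form a base of neighborhoods of zero. Then $\mathfrak H(R)$ is the set of all $h\in R$ such that, for all $w,z\in Z$, the matrix entry $h_{w,z}\colon M_w\to M_z$ of $h$ is not an isomorphism. -/

import Mathlib

open Filter Topology MulOpposite

universe u v w x

/-! Right `R`-modules are modules over `Rᵐᵒᵖ`; right ideals of `R` are `Submodule Rᵐᵒᵖ R`. -/

/-- The completion map `A → lim A/U`, with `U` ranging over the open subgroups of `A`, is
surjective. An element of the limit is given by representatives `a U` of its components in `A/U`,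
compatible under the projections `A/U → A/V` for `U ≤ V`. -/
def IsLinearlyComplete (A : Type u) [AddCommGroup A] [TopologicalSpace A] : Prop :=
  ∀ a : OpenAddSubgroup A → A, (∀ U V : OpenAddSubgroup A, U ≤ V → a U - a V ∈ V) →
    ∃ b : A, ∀ U : OpenAddSubgroup A, a U - b ∈ U

/-- Complete, separated, right linear topological rings. `IsLinearTopology Rᵐᵒᵖ R` says that the
open right ideals form a base of neighborhoods of zero. -/
class IsCompleteRightLinear (R : Type u) [Ring R] [TopologicalSpace R] : Prop extends
    IsTopologicalRing R, IsLinearTopology Rᵐᵒᵖ R, T2Space R where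
  complete : IsLinearlyComplete R

/-- A family of elements converging to zero: every neighborhood of zero contains all but finitely
many members of the family. -/
def ZeroConvergent {X : Type u} {A : Type v} [AddCommGroup A] [TopologicalSpace A]
    (a : X → A) : Prop :=
  Tendsto a cofinite (𝓝 0)

/-- A strongly closed subgroup: closed, with complete quotient group, and such that zero-convergent
families in the quotient lift to zero-convergent families. (A zero-convergent family in a separated
group takes every nonzero value finitely many times only, so that index sets in the universe of `A`
suffice.) -/
structure IsStronglyClosed {A : Type u} [AddCommGroup A] [TopologicalSpace A]
    (H : AddSubgroup A) : Prop where
  isClosed : IsClosed (H : Set A)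
  complete : IsLinearlyComplete (A ⧸ H)
  lift : ∀ (X : Type u) (q : X → A ⧸ H), ZeroConvergent q →
    ∃ a : X → A, ZeroConvergent a ∧ ∀ i, (QuotientAddGroup.mk (a i) : A ⧸ H) = q i

/-- A right module is discrete if the annihilator of each of its elements is open. -/
def IsDiscreteRightModule (R : Type u) [Ring R] [TopologicalSpace R]
    (N : Type v) [AddCommGroup N] [Module Rᵐᵒᵖ N] : Prop :=
  ∀ n : N, IsOpen {r : R | op r • n = 0}

/-- A (complete, separated, right linear) topological ring is topologically semisimple if the
abelian category of its discrete right modules is split, that is, if every submodule of a discrete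
right module is a direct summand. (Discrete modules are sums of cyclic ones, which are quotients of
the ring; so modules in the universe of the ring suffice.) -/
structure IsTopologicallySemisimple (S : Type u) [Ring S] [TopologicalSpace S] : Prop where
  isCompleteRightLinear : IsCompleteRightLinear S
  isSemisimpleModule : ∀ (N : Type u) [AddCommGroup N] [Module Sᵐᵒᵖ N],
    IsDiscreteRightModule S N → IsSemisimpleModule Sᵐᵒᵖ N

/-- A topological ring is topologically semiperfect if its unit is the sum of a zero-convergent
family of pairwise orthogonal idempotents `e z` with local rings `(e z) R (e z)`. -/
def IsTopologicallySemiperfect (R : Type u) [Ring R] [TopologicalSpace R] : Prop :=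
  ∃ (Z : Type u) (e : Z → R) (he : OrthogonalIdempotents e),
    ZeroConvergent e ∧ HasSum e 1 ∧ ∀ z, IsLocalRing (he.idem z).Corner

/-- The topological Jacobson radical: the intersection of the open maximal right ideals. -/
def topologicalJacobson (R : Type u) [Ring R] [TopologicalSpace R] : Submodule Rᵐᵒᵖ R :=
  sInf {I | IsCoatom I ∧ IsOpen (I : Set R)}

theorem mul_mem_topologicalJacobson {R : Type u} [Ring R] [TopologicalSpace R]
    [IsTopologicalRing R] (r : R) {h : R} (hh : h ∈ topologicalJacobson R) :
    r * h ∈ topologicalJacobson R := by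
  rw [topologicalJacobson, Submodule.mem_sInf] at hh ⊢
  rintro I ⟨hI, hIo⟩
  let f : R →ₗ[Rᵐᵒᵖ] R :=
    { toFun := fun y => r * y
      map_add' := mul_add r
      map_smul' := fun c y => by simp [MulOpposite.smul_eq_mul_unop, mul_assoc] }
  by_cases htop : I.comap f = ⊤
  · have : h ∈ I.comap f := by rw [htop]; trivial
    exact this
  · refine hh (I.comap f) ⟨⟨htop, fun J hJ => ?_⟩, hIo.preimage (continuous_const_mul r)⟩
    obtain ⟨y, hyJ, hyI⟩ := SetLike.exists_of_lt hJ
    have hsup : I ⊔ J.map f = ⊤ := by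
      refine hI.2 _ (lt_of_le_of_ne le_sup_left fun heq => hyI ?_)
      have : f y ∈ I ⊔ J.map f := Submodule.mem_sup_right (Submodule.mem_map_of_mem hyJ)
      rw [← heq] at this
      exact this
    rw [eq_top_iff]
    intro t _
    have ht : f t ∈ I ⊔ J.map f := by rw [hsup]; trivial
    obtain ⟨a, ha, b, ⟨j, hj, rfl⟩, hab⟩ := Submodule.mem_sup.1 ht
    have hk : t - j ∈ I.comap f := by
      rw [Submodule.mem_comap, map_sub, ← hab]
      simpa using ha
    have := J.add_mem (hJ.le hk) hj
    simpa using this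

/-- The topological Jacobson radical as a two-sided ideal. -/
def topologicalJacobsonIdeal (R : Type u) [Ring R] [TopologicalSpace R] [IsTopologicalRing R] :
    Ideal R where
  carrier := topologicalJacobson R
  zero_mem' := (topologicalJacobson R).zero_mem
  add_mem' := (topologicalJacobson R).add_mem
  smul_mem' r _ hh := mul_mem_topologicalJacobson r hh

instance (R : Type u) [Ring R] [TopologicalSpace R] [IsTopologicalRing R] :
    (topologicalJacobsonIdeal R).IsTwoSided :=
  ⟨fun b ha => (topologicalJacobson R).smul_mem (op b) ha⟩

/-- The ring `End_A(M)ᵒᵖ` of endomorphisms of a left module `M`, acting on `M` on the right. -/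
abbrev RightEnd (A : Type v) (M : Type w) [Ring A] [AddCommGroup M] [Module A M] : Type w :=
  (Module.End A M)ᵐᵒᵖ

/-- The finite topology on `End_A(M)ᵒᵖ`, that is, the topology of pointwise convergence on the
discrete set `M`: the annihilators of finite subsets of `M` form a base of neighborhoods of zero. -/
instance finiteTopology (A : Type v) (M : Type w) [Ring A] [AddCommGroup M] [Module A M] :
    TopologicalSpace (RightEnd A M) :=
  TopologicalSpace.induced (fun r (m : M) => r.unop m)
    (@Pi.topologicalSpace M (fun _ => M) fun _ => ⊥)

/-- The matrix entry `M w → M z` of an endomorphism of `⨁ z, M z`. -/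
def matrixEntry {A : Type v} [Ring A] {Z : Type w} [DecidableEq Z] {M : Z → Type x}
    [∀ z, AddCommGroup (M z)] [∀ z, Module A (M z)] (h : RightEnd A (DirectSum Z M)) (w z : Z) :
    M w →ₗ[A] M z :=
  DirectSum.component A Z M z ∘ₗ h.unop ∘ₗ DirectSum.lof A Z M w

/-! For a local idempotent `e`, the elements `r` with `e ∉ erR` form an open maximal right ideal,
`rightIdeal`, which depends only on the row `e * r`. When local idempotents `e z` sum to 1, the
topological Jacobson radical is the intersection of these ideals `I z`
(`mem_topologicalJacobson_iff`). For (1), rows can be prescribed freely: `∑ e z * a z` converges for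
every choice of the `a z`, because open right ideals absorb right factors. Limits and
zero-convergent lifts modulo the radical are thus built row by row, and an open right ideal controls
all but finitely many rows. In the quotient each `e z` generates a simple right ideal, so discrete
modules are sums of simple ones. For (2), the projections onto the `M z` are local idempotents with
sum 1, and `h` avoids `I w` exactly when some entry out of `M w` is invertible. -/

/-- An idempotent `e` of a ring `R` for which the ring `eRe` is local, in terms of right
invertibility in `eRe`. -/
structure IsLocalIdempotent {R : Type u} [Ring R] (e : R) : Prop where
  idem : e * e = e
  ne_zero : e ≠ 0
  exists_mul_eq : ∀ x, (∃ c, e * x * e * c = e) ∨ ∃ c, (e - e * x * e) * c = e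

theorem isLocalIdempotent_of_isLocalRing_corner {R : Type u} [Ring R] {e : R}
    (he : IsIdempotentElem e) (h : IsLocalRing he.Corner) : IsLocalIdempotent e where
  idem := he
  ne_zero := fun h0 => by
    have : (1 : he.Corner) = 0 := Subtype.ext h0
    exact one_ne_zero this
  exists_mul_eq := fun x => by
    have hx : e * x * e ∈ Subsemigroup.corner e := ⟨x, rfl⟩
    let y : he.Corner := ⟨e * x * e, hx⟩
    have hy : y + (1 - y) = 1 := add_sub_cancel _ _
    rcases IsLocalRing.isUnit_or_isUnit_of_add_one hy with hu | hu
    · obtain ⟨c, hc⟩ := hu.exists_right_inv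
      exact Or.inl ⟨c.1, congrArg Subtype.val hc⟩
    · obtain ⟨c, hc⟩ := hu.exists_right_inv
      exact Or.inr ⟨c.1, congrArg Subtype.val hc⟩

/-! ### Local idempotents and their maximal right ideals. -/

namespace IsLocalIdempotent

section

variable {R : Type u} [Ring R] {e : R}

/-- In the local ring `eRe`, either `f` or `e - f` is right invertible; since `f * (e - f) = 0`, the
latter forces `f = 0`. -/
theorem eq_of_idem (he : IsLocalIdempotent e) {f : R} (hef : e * f = f) (hfe : f * e = f)
    (hf : f * f = f) (h0 : f ≠ 0) : f = e := by
  have h1 : e * f * e = f := by rw [hef, hfe]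
  rcases he.exists_mul_eq f with ⟨c, hc⟩ | ⟨c, hc⟩
  · rw [h1] at hc
    calc f = f * e := hfe.symm
      _ = f * f * c := by rw [← hc, mul_assoc]
      _ = e := by rw [hf, hc]
  · refine absurd ?_ h0
    rw [h1] at hc
    calc f = f * e := hfe.symm
      _ = (f * e - f * f) * c := by rw [← mul_sub, mul_assoc, hc]
      _ = 0 := by rw [hfe, hf, sub_self, zero_mul]

/-- A one-sided inverse between local idempotents is two-sided. -/
theorem mul_eq_of_mul_eq {f x y : R} (he : IsLocalIdempotent e) (hf : IsLocalIdempotent f)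
    (hx : e * x * f = x) (hy : f * y * e = y) (h : x * y = e) : y * x = f := by
  have hex : e * x = x := by rw [← hx, ← mul_assoc, ← mul_assoc, he.idem]
  have hxf : x * f = x := by rw [← hx, mul_assoc, hf.idem]
  have hfy : f * y = y := by rw [← hy, ← mul_assoc, ← mul_assoc, hf.idem]
  refine hf.eq_of_idem (by rw [← mul_assoc, hfy]) (by rw [mul_assoc, hxf]) ?_ fun h0 => he.ne_zero ?_
  · rw [mul_assoc, ← mul_assoc x, h, hex]
  · calc e = (x * y) * (x * y) := by rw [h, he.idem]
      _ = x * (y * x) * y := by simp only [mul_assoc]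
      _ = 0 := by rw [h0, mul_zero, zero_mul]

theorem exists_inverse_of_mul_eq {f a b : R} (he : IsLocalIdempotent e) (hf : IsLocalIdempotent f)
    (h : e * (a * f) * b = e) :
    e * a * f * (f * b * e) = e ∧ f * b * e * (e * a * f) = f := by
  have h1 : e * a * f * (f * b * e) = e := by
    calc _ = e * (a * (f * f)) * b * e := by simp only [mul_assoc]
      _ = e := by rw [hf.idem, h, he.idem]
  exact ⟨h1, he.mul_eq_of_mul_eq hf
    (by simp only [← mul_assoc]; rw [he.idem]; simp only [mul_assoc]; rw [hf.idem])
    (by simp only [← mul_assoc]; rw [hf.idem]; simp only [mul_assoc]; rw [he.idem]) h1⟩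

/-- For a local idempotent `e`, the maximal right ideal of all `r` with `e ∉ erR`. -/
def rightIdeal (he : IsLocalIdempotent e) : Submodule Rᵐᵒᵖ R where
  carrier := {r | ∀ b, e * r * b ≠ e}
  zero_mem' := fun b => by simpa using he.ne_zero.symm
  add_mem' := fun {r s} hr hs b hb => by
    -- Two elements of `eRe` with sum `e`: by locality one of them is right invertible.
    have h1 : e * (r * b) * e + e * (s * b) * e = e := by
      calc _ = e * (r + s) * b * e := by noncomm_ring
        _ = e := by rw [hb, he.idem]
    rcases he.exists_mul_eq (r * b) with ⟨c, hc⟩ | ⟨c, hc⟩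
    · exact hr (b * (e * c)) (.trans (by simp only [mul_assoc]) hc)
    · rw [← eq_sub_iff_add_eq'.2 h1] at hc
      exact hs (b * (e * c)) (by simpa only [mul_assoc] using hc)
  smul_mem' := fun c r hr b hb => hr (c.unop * b) (by
    simpa only [MulOpposite.smul_eq_mul_unop, mul_assoc] using hb)

theorem mem_rightIdeal (he : IsLocalIdempotent e) {r : R} :
    r ∈ he.rightIdeal ↔ ∀ b, e * r * b ≠ e := Iff.rfl

theorem notMem_rightIdeal (he : IsLocalIdempotent e) {r : R} :
    r ∉ he.rightIdeal ↔ ∃ b, e * r * b = e := by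
  simp [mem_rightIdeal]

theorem isCoatom_rightIdeal (he : IsLocalIdempotent e) : IsCoatom he.rightIdeal := by
  refine ⟨fun h => ?_, fun J hJ => ?_⟩
  · have : e ∈ he.rightIdeal := h ▸ Submodule.mem_top
    exact this e (by rw [he.idem, he.idem])
  · obtain ⟨r, hrJ, hr⟩ := SetLike.exists_of_lt hJ
    obtain ⟨b, hb⟩ := he.notMem_rightIdeal.1 hr
    rw [eq_top_iff]
    intro t _
    have h1 : r * (b * t) ∈ J := J.smul_mem (op (b * t)) hrJ
    -- Left multiplication by `e` kills `t - r * (b * t)`, as `e * r * b = e`.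
    have h2 : t - r * (b * t) ∈ he.rightIdeal := fun c hc => he.ne_zero <| by
      rw [← hc, mul_sub, ← mul_assoc, ← mul_assoc, hb, sub_self, zero_mul]
    simpa using J.add_mem (hJ.le h2) h1

theorem isOpen_rightIdeal [TopologicalSpace R] [IsTopologicalRing R] [IsLinearTopology Rᵐᵒᵖ R]
    [T2Space R] (he : IsLocalIdempotent e) : IsOpen (he.rightIdeal : Set R) := by
  have h1 : ({e}ᶜ : Set R) ∈ 𝓝 0 := isOpen_compl_singleton.mem_nhds he.ne_zero.symm
  obtain ⟨J, hJ, hJe⟩ := (IsLinearTopology.hasBasis_open_submodule Rᵐᵒᵖ).mem_iff.1 h1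
  refine he.rightIdeal.toAddSubgroup.isOpen_of_mem_nhds (g := 0) ?_
  have h2 : IsOpen ((fun r => e * r) ⁻¹' (J : Set R)) := hJ.preimage (continuous_const_mul e)
  refine mem_of_superset (h2.mem_nhds (by simp)) fun r hr b hb => ?_
  have : e * r * b ∈ J := J.smul_mem (op b) hr
  exact hJe this hb

end

end IsLocalIdempotent

/-! ### The radical as an intersection of the ideals of local idempotents. -/

section Sums

variable {R : Type u} [Ring R] [TopologicalSpace R] [IsTopologicalRing R] {Z : Type v} {e : Z → R}

theorem HasSum.mem_addSubgroup_of_isOpen {A : Type u} [AddCommGroup A] [TopologicalSpace A]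
    [IsTopologicalAddGroup A] {Z : Type v} {f : Z → A} {a : A} (h : HasSum f a)
    {I : AddSubgroup A} (hI : IsOpen (I : Set A)) (hf : ∀ z, f z ∈ I) : a ∈ I := by
  have h1 : IsClosed (I : Set A) := I.isClosed_of_isOpen hI
  exact h1.mem_of_tendsto h (Eventually.of_forall fun s => I.sum_mem fun z _ => hf z)

theorem mem_of_forall_mul_mem (hsum : HasSum e 1) {I : AddSubgroup R} (hI : IsOpen (I : Set R))
    {r : R} (h : ∀ z, e z * r ∈ I) : r ∈ I := by
  simpa using (hsum.mul_right r).mem_addSubgroup_of_isOpen hI (by simpa using h)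

theorem mem_of_forall_mul_mem_left (hsum : HasSum e 1) {I : AddSubgroup R}
    (hI : IsOpen (I : Set R)) {r : R} (h : ∀ z, r * e z ∈ I) : r ∈ I := by
  simpa using (hsum.mul_left r).mem_addSubgroup_of_isOpen hI (by simpa using h)

variable [IsLinearTopology Rᵐᵒᵖ R] [T2Space R]

/-- If `e z` factors through `e w * h`, the factorization can be reversed because one-sided inverses
are two-sided; then `e w` lies in `e w * h * R`, against `h ∈ I w`. Summing over `w` inserts 1
between `r` and `h`. -/
theorem mul_mul_mem_of_forall_mem (hsum : HasSum e 1)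
    (hl : ∀ z, IsLocalIdempotent (e z)) {h : R} (hh : ∀ z, h ∈ (hl z).rightIdeal) (r s : R)
    (z : Z) : r * h * s ∈ (hl z).rightIdeal := by
  have key : ∀ w b, e z * r * (e w * h * b) ∈ (hl z).rightIdeal := fun w b => by
    by_contra hcon
    obtain ⟨c, hc⟩ := (hl z).notMem_rightIdeal.1 hcon
    have h1 : e z * (r * e w) * (h * b * c) = e z := by
      refine .trans ?_ hc
      simp only [← mul_assoc]; rw [(hl z).idem]
    refine hh w (b * c * e z * (e z * r * e w)) ?_
    simpa only [mul_assoc] using ((hl z).exists_inverse_of_mul_eq (hl w) h1).2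
  have h3 : e z * r * h * s ∈ (hl z).rightIdeal := by
    have hs := (hsum.mul_left (e z * r)).mul_right (h * s)
    have := hs.mem_addSubgroup_of_isOpen (I := (hl z).rightIdeal.toAddSubgroup)
      (hl z).isOpen_rightIdeal fun w => by
        have := key w s
        simp only [mul_assoc] at this ⊢
        exact this
    simp only [mul_assoc, mul_one] at this ⊢
    exact this
  intro b hb
  refine h3 b (.trans ?_ hb)
  simp only [← mul_assoc]; rw [(hl z).idem]

theorem mem_topologicalJacobson_iff (hsum : HasSum e 1)
    (hl : ∀ z, IsLocalIdempotent (e z)) {h : R} :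
    h ∈ topologicalJacobson R ↔ ∀ z, h ∈ (hl z).rightIdeal := by
  rw [topologicalJacobson, Submodule.mem_sInf]
  refine ⟨fun hh z => hh _ ⟨(hl z).isCoatom_rightIdeal, (hl z).isOpen_rightIdeal⟩, ?_⟩
  rintro hh I ⟨hI, hIo⟩
  by_contra hhI
  have h1 : ∃ w, h * e w ∉ I := by
    by_contra! hcon
    exact hhI (mem_of_forall_mul_mem_left (I := I.toAddSubgroup) hsum hIo hcon)
  obtain ⟨w, hw⟩ := h1
  have h2 : ∃ z, e z * (h * e w) ∉ I := by
    by_contra! hcon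
    exact hw (mem_of_forall_mul_mem (I := I.toAddSubgroup) hsum hIo hcon)
  obtain ⟨z, hz⟩ := h2
  set x := e z * (h * e w) with hx
  have hez : e z * x = x := by rw [hx, ← mul_assoc, (hl z).idem]
  have hsup : I ⊔ Submodule.span Rᵐᵒᵖ {x} = ⊤ :=
    hI.2 _ (lt_of_le_of_ne le_sup_left fun heq => hz <| by
      rw [heq]; exact Submodule.mem_sup_right (Submodule.mem_span_singleton_self x))
  have hmem : e z ∈ I ⊔ Submodule.span Rᵐᵒᵖ {x} := hsup ▸ Submodule.mem_top
  obtain ⟨i, hi, j, hj, hij⟩ := Submodule.mem_sup.1 hmem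
  obtain ⟨c, rfl⟩ := Submodule.mem_span_singleton.1 hj
  rw [MulOpposite.smul_eq_mul_unop] at hij
  -- Now `e z = i + x * c` with `i ∈ I`. If the `x`-part is invertible in the corner, `h` leaves the
  -- ideal of `e z`; if the `i`-part is, then `e z ∈ I` and hence `x ∈ I`.
  rcases (hl z).exists_mul_eq (x * c.unop) with ⟨d, hd⟩ | ⟨d, hd⟩
  · refine mul_mul_mem_of_forall_mem hsum hl hh (e z) (e w) z (c.unop * e z * d) ?_
    refine .trans ?_ hd
    rw [← mul_assoc (e z) x, hez, hx]
    simp only [← mul_assoc]; rw [(hl z).idem]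
  · have h3 : e z - e z * (x * c.unop) * e z ∈ I := by
      have : e z - e z * (x * c.unop) * e z = i * e z := by
        rw [← mul_assoc, hez, eq_sub_of_add_eq hij, sub_mul, (hl z).idem]
      rw [this]; exact I.smul_mem (op (e z)) hi
    have h4 : e z ∈ I := by
      rw [← hd]; exact I.smul_mem (op d) h3
    refine hz ?_
    rw [hx]
    exact I.smul_mem (op (h * e w)) h4

end Sums

/-! ### Convergent sums from completeness. -/

theorem IsLinearlyComplete.exists_hasSum {A : Type u} [AddCommGroup A] [TopologicalSpace A]
    [NonarchimedeanAddGroup A] (hA : IsLinearlyComplete A) {Z : Type v} {f : Z → A}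
    (hf : ZeroConvergent f) : ∃ b, HasSum f b := by
  classical
  have hfin : ∀ U : OpenAddSubgroup A, {z | f z ∉ U}.Finite := fun U => hf U.mem_nhds_zero
  -- Modulo `U` the sum is represented by its finitely many terms outside `U`.
  obtain ⟨b, hb⟩ := hA (fun U => ∑ z ∈ (hfin U).toFinset, f z) fun U V hUV => by
    have hsub : (hfin V).toFinset ⊆ (hfin U).toFinset := fun z hz => by
      simp only [Set.Finite.mem_toFinset, Set.mem_ofPred_eq] at hz ⊢
      exact fun h => hz (hUV h)
    rw [← Finset.sum_sdiff hsub, add_sub_cancel_right]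
    refine sum_mem fun z hz => ?_
    simpa using (Finset.mem_sdiff.1 hz).2
  refine ⟨b, ?_⟩
  change Tendsto (fun s : Finset Z => ∑ z ∈ s, f z) atTop (𝓝 b)
  rw [← tendsto_sub_nhds_zero_iff]
  intro N hN
  obtain ⟨U, hU⟩ := NonarchimedeanAddGroup.is_nonarchimedean N hN
  change ∀ᶠ s in atTop, ∑ z ∈ s, f z - b ∈ N
  filter_upwards [eventually_ge_atTop (hfin U).toFinset] with s hs
  refine hU ?_
  rw [← Finset.sum_sdiff (show (hfin U).toFinset ⊆ s from hs), add_sub_assoc]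
  refine U.add_mem (sum_mem fun z hz => ?_) (hb U)
  simpa using (Finset.mem_sdiff.1 hz).2

theorem IsLinearTopology.nonarchimedeanAddGroup (R : Type u) (M : Type v) [Ring R] [AddCommGroup M]
    [Module R M] [TopologicalSpace M] [IsTopologicalAddGroup M] [IsLinearTopology R M] :
    NonarchimedeanAddGroup M where
  is_nonarchimedean U hU := by
    obtain ⟨J, hJ, hJU⟩ := (IsLinearTopology.hasBasis_open_submodule R).mem_iff.1 hU
    exact ⟨⟨J.toAddSubgroup, hJ⟩, hJU⟩

theorem ZeroConvergent.finite_notMem {Z : Type v} {A : Type u} [AddCommGroup A]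
    [TopologicalSpace A] {f : Z → A} (hf : ZeroConvergent f) {I : AddSubgroup A}
    (hI : IsOpen (I : Set A)) : {z | f z ∉ I}.Finite :=
  hf (hI.mem_nhds I.zero_mem)

theorem ZeroConvergent.exists_hasSum_mul {R : Type u} [Ring R] [TopologicalSpace R]
    [IsCompleteRightLinear R] {Z : Type v} {e : Z → R} (he : ZeroConvergent e) (a : Z → R) :
    ∃ b, HasSum (fun z => e z * a z) b := by
  have := IsLinearTopology.nonarchimedeanAddGroup Rᵐᵒᵖ R
  refine IsCompleteRightLinear.complete.exists_hasSum fun N hN => ?_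
  obtain ⟨J, hJ, hJN⟩ := (IsLinearTopology.hasBasis_open_submodule Rᵐᵒᵖ).mem_iff.1 hN
  change ∀ᶠ z in cofinite, e z * a z ∈ N
  filter_upwards [he (hJ.mem_nhds J.zero_mem)] with z hz
  exact hJN (J.smul_mem (op (a z)) hz)

theorem isClosed_topologicalJacobson (R : Type u) [Ring R] [TopologicalSpace R]
    [IsTopologicalRing R] : IsClosed (topologicalJacobson R : Set R) := by
  rw [topologicalJacobson, Submodule.coe_sInf]
  exact isClosed_biInter fun I hI => I.toAddSubgroup.isClosed_of_isOpen hI.2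

theorem IsLocalIdempotent.mem_rightIdeal_iff_of_mul_eq {R : Type u} [Ring R] {e r s : R}
    (he : IsLocalIdempotent e) (h : e * r = e * s) : r ∈ he.rightIdeal ↔ s ∈ he.rightIdeal := by
  simp only [he.mem_rightIdeal, h]

/-! ### Strong closedness of the radical. -/

section Semiperfect

variable {R : Type u} [Ring R] [TopologicalSpace R] {Z : Type v} {e : Z → R}

theorem mul_mem_rightIdeal_of_mem [IsTopologicalRing R] (he : OrthogonalIdempotents e)
    (hl : ∀ z, IsLocalIdempotent (e z)) {w : Z} {r : R} (hr : r ∈ (hl w).rightIdeal) (z : Z) :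
    e w * r ∈ (hl z).rightIdeal := by
  intro b hb
  by_cases h : z = w
  · subst h
    exact hr b (by rwa [← mul_assoc, (hl z).idem] at hb)
  · rw [← mul_assoc, he.ortho h, zero_mul, zero_mul] at hb
    exact (hl z).ne_zero hb.symm

/-- Modulo the radical, finite intersections of the `I w` are arbitrarily small. Take for `F` the
finitely many `w` with `e w ∉ J`: the rows of `r` in `F` add up to an element of the radical, and
the remaining rows lie in `J`. -/
theorem exists_finset_forall_mem_rightIdeal [IsTopologicalRing R] [IsLinearTopology Rᵐᵒᵖ R]
    [T2Space R] (he : OrthogonalIdempotents e) (hz : ZeroConvergent e) (hsum : HasSum e 1)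
    (hl : ∀ z, IsLocalIdempotent (e z)) {U : Set R} (hU : U ∈ 𝓝 0) :
    ∃ F : Finset Z, ∀ r, (∀ w ∈ F, r ∈ (hl w).rightIdeal) →
      ∃ h ∈ topologicalJacobson R, r - h ∈ U := by
  classical
  obtain ⟨J, hJ, hJU⟩ := (IsLinearTopology.hasBasis_open_submodule Rᵐᵒᵖ).mem_iff.1 hU
  have hfin := hz.finite_notMem (I := J.toAddSubgroup) hJ
  refine ⟨hfin.toFinset, fun r hr => ⟨∑ w ∈ hfin.toFinset, e w * r, ?_, hJU ?_⟩⟩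
  · refine sum_mem fun w hw => (mem_topologicalJacobson_iff hsum hl).2 fun z =>
      mul_mem_rightIdeal_of_mem he hl (hr w hw) z
  · refine mem_of_forall_mul_mem (I := J.toAddSubgroup) hsum hJ fun z => ?_
    rw [mul_sub, Finset.mul_sum]
    simp only [← mul_assoc, he.mul_eq, ite_mul, zero_mul, Finset.sum_ite_eq]
    split_ifs with h
    · simp
    · rw [sub_zero]
      have : e z ∈ J := by simpa using h
      exact J.smul_mem (op r) this

variable [IsCompleteRightLinear R]

theorem topologicalJacobson_exists_lift (he : OrthogonalIdempotents e) (hz : ZeroConvergent e)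
    (a : Z → R) : ∃ b, HasSum (fun z => e z * a z) b ∧ ∀ z, e z * b = e z * a z := by
  obtain ⟨b, hb⟩ := hz.exists_hasSum_mul a
  refine ⟨b, hb, fun z => ?_⟩
  have h1 := hb.mul_left (e z)
  have h2 := hasSum_single (f := fun w => e z * (e w * a w)) z fun w hw => by
    rw [← mul_assoc, he.ortho hw.symm, zero_mul]
  rw [h1.unique h2, ← mul_assoc, (he.idem z).eq]

theorem isStronglyClosed_topologicalJacobson (he : OrthogonalIdempotents e)
    (hz : ZeroConvergent e) (hsum : HasSum e 1) (hl : ∀ z, IsLocalIdempotent (e z)) :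
    IsStronglyClosed (topologicalJacobsonIdeal R).toAddSubgroup where
  isClosed := isClosed_topologicalJacobson R
  complete := by
    set H := (topologicalJacobsonIdeal R).toAddSubgroup with hH
    have hHI : ∀ z, H ≤ (hl z).rightIdeal.toAddSubgroup := fun z h hh =>
      (mem_topologicalJacobson_iff hsum hl).1 hh z
    intro a ha
    let Q : Z → OpenAddSubgroup (R ⧸ H) := fun z =>
      ⟨(hl z).rightIdeal.toAddSubgroup.map (QuotientAddGroup.mk' H),
        QuotientAddGroup.isOpenMap_coe _ (hl z).isOpen_rightIdeal⟩
    have hQ : ∀ (z : Z) (r : R), (r : R ⧸ H) ∈ Q z ↔ r ∈ (hl z).rightIdeal := by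
      refine fun z r => ⟨?_, fun h => ⟨r, h, rfl⟩⟩
      rintro ⟨s, hs, hsr⟩
      have h1 : -s + r ∈ H := QuotientAddGroup.eq.1 hsr
      simpa using (hl z).rightIdeal.add_mem hs (hHI z h1)
    choose c hc using fun z => QuotientAddGroup.mk_surjective (a (Q z))
    obtain ⟨b, -, hb⟩ := topologicalJacobson_exists_lift he hz c
    refine ⟨b, fun U => ?_⟩
    have hU : ((QuotientAddGroup.mk : R → R ⧸ H) ⁻¹' (U : Set (R ⧸ H))) ∈ 𝓝 0 :=
      (U.isOpen.preimage QuotientAddGroup.continuous_mk).mem_nhds U.zero_mem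
    obtain ⟨F, hF⟩ := exists_finset_forall_mem_rightIdeal he hz hsum hl hU
    -- Small enough that the representative at `V` agrees with `b` modulo `I w` for all `w ∈ F`,
    -- while still refining `U`.
    let V : OpenAddSubgroup (R ⧸ H) := U ⊓ F.inf Q
    have hVU : a V - a U ∈ U := ha V U inf_le_left
    obtain ⟨v, hv⟩ := QuotientAddGroup.mk_surjective (a V)
    obtain ⟨h, hh, hvb⟩ := hF (v - b) fun w hw => by
      have h1 : a V - a (Q w) ∈ Q w := ha V (Q w) (inf_le_right.trans (Finset.inf_le hw))
      rw [← hv, ← hc, ← QuotientAddGroup.mk_sub, hQ] at h1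
      refine ((hl w).mem_rightIdeal_iff_of_mul_eq ?_).2 h1
      rw [mul_sub, mul_sub, hb]
    have h2 : a V - b ∈ U := by
      have h3 : ((v - b - h : R) : R ⧸ H) ∈ U := hvb
      rwa [QuotientAddGroup.mk_sub, (QuotientAddGroup.eq_zero_iff h).2 hh, sub_zero,
        QuotientAddGroup.mk_sub, hv] at h3
    have := U.sub_mem h2 hVU
    rwa [sub_sub_sub_cancel_left, ← neg_sub, ← neg_sub, neg_neg] at this
  lift := by
    classical
    set H := (topologicalJacobsonIdeal R).toAddSubgroup with hH
    intro X q hq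
    choose s hs using fun i => QuotientAddGroup.mk_surjective (q i)
    -- Deleting the rows of `s i` that lie in `I z` keeps the class modulo the radical. For each `z`
    -- this deletes the row for almost all `i`, which gives convergence to zero.
    let c : X → Z → R := fun i z => if s i ∈ (hl z).rightIdeal then 0 else s i
    choose a ha hab using fun i => topologicalJacobson_exists_lift he hz (c i)
    refine ⟨a, fun N hN => ?_, fun i => ?_⟩
    · obtain ⟨J, hJ, hJN⟩ := (IsLinearTopology.hasBasis_open_submodule Rᵐᵒᵖ).mem_iff.1 hN
      have hfin := hz.finite_notMem (I := J.toAddSubgroup) hJ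
      have h1 : ∀ z, ∀ᶠ i in cofinite, s i ∈ (hl z).rightIdeal := fun z => by
        have h2 : (QuotientAddGroup.mk : R → R ⧸ H) '' (hl z).rightIdeal ∈ 𝓝 (0 : R ⧸ H) :=
          (QuotientAddGroup.isOpenMap_coe _ (hl z).isOpen_rightIdeal).mem_nhds
            ⟨0, (hl z).rightIdeal.zero_mem, rfl⟩
        filter_upwards [hq h2]
        rintro i ⟨t, ht, hti⟩
        have h3 : -t + s i ∈ H := QuotientAddGroup.eq.1 (hti.trans (hs i).symm)
        have h4 := (mem_topologicalJacobson_iff hsum hl).1 h3 z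
        simpa using (hl z).rightIdeal.add_mem ht h4
      have h2 : ∀ᶠ i in cofinite, ∀ z ∈ {z | e z ∉ J.toAddSubgroup}, s i ∈ (hl z).rightIdeal :=
        (eventually_all_finite hfin).2 fun z _ => h1 z
      change ∀ᶠ i in cofinite, a i ∈ N
      filter_upwards [h2] with i hi
      refine hJN ((ha i).mem_addSubgroup_of_isOpen (I := J.toAddSubgroup) hJ fun z => ?_)
      by_cases hzJ : e z ∈ J
      · exact J.smul_mem (op (c i z)) hzJ
      · simp only [c, if_pos (hi z hzJ), mul_zero]
        exact J.zero_mem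
    · rw [← hs, QuotientAddGroup.eq]
      refine (mem_topologicalJacobson_iff hsum hl).2 fun z => ?_
      by_cases hsz : s i ∈ (hl z).rightIdeal
      · refine (hl z).rightIdeal.add_mem ((hl z).rightIdeal.neg_mem ?_) hsz
        refine ((hl z).mem_rightIdeal_iff_of_mul_eq (s := 0) ?_).2 (Submodule.zero_mem _)
        rw [hab]; simp only [c, if_pos hsz]
      · refine ((hl z).mem_rightIdeal_iff_of_mul_eq (s := 0) ?_).2 (Submodule.zero_mem _)
        rw [mul_add, mul_neg, hab]; simp only [c, if_neg hsz, neg_add_cancel, mul_zero]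

end Semiperfect

/-! ### Topological semisimplicity of the quotient. -/

section Quotient

variable {R : Type u} [Ring R] [TopologicalSpace R] [IsTopologicalRing R]

theorem Ideal.isTopologicalRing_quotient (I : Ideal R) [I.IsTwoSided] :
    IsTopologicalRing (R ⧸ I) where
  __ := QuotientAddGroup.instIsTopologicalAddGroup I.toAddSubgroup
  continuous_mul := by
    have h : IsOpenQuotientMap (Ideal.Quotient.mk I) :=
      QuotientAddGroup.isOpenQuotientMap_mk (N := I.toAddSubgroup)
    exact (h.prodMap h).isQuotientMap.continuous_iff.2 (continuous_quot_mk.comp continuous_mul)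

theorem Ideal.isLinearTopology_quotient [IsLinearTopology Rᵐᵒᵖ R] (I : Ideal R) [I.IsTwoSided] :
    IsLinearTopology (R ⧸ I)ᵐᵒᵖ (R ⧸ I) where
  hasBasis_submodule' := by
    have hq : IsOpenQuotientMap (Ideal.Quotient.mk I) :=
      QuotientAddGroup.isOpenQuotientMap_mk (N := I.toAddSubgroup)
    refine ⟨fun U => ⟨fun hU => ?_, fun ⟨N, hN, hNU⟩ => mem_of_superset hN hNU⟩⟩
    have h1 : (Ideal.Quotient.mk I) ⁻¹' U ∈ 𝓝 0 :=
      hq.continuous.continuousAt.preimage_mem_nhds (by rwa [map_zero])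
    obtain ⟨J, hJ, hJU⟩ := (IsLinearTopology.hasBasis_open_submodule Rᵐᵒᵖ).mem_iff.1 h1
    refine ⟨⟨J.toAddSubgroup.toAddSubmonoid.map (Ideal.Quotient.mk I), ?_⟩, ?_, ?_⟩
    · rintro c _ ⟨j, hj, rfl⟩
      obtain ⟨r, hr⟩ := Ideal.Quotient.mk_surjective c.unop
      refine ⟨j * r, J.smul_mem (op r) hj, ?_⟩
      rw [MulOpposite.smul_eq_mul_unop, ← hr]
      exact map_mul _ _ _
    · exact (hq.isOpenMap _ hJ).mem_nhds ⟨0, J.zero_mem, map_zero _⟩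
    · rintro _ ⟨j, hj, rfl⟩
      exact hJU hj

end Quotient

theorem isSemisimpleModule_of_isDiscreteRightModule {S : Type u} [Ring S] [TopologicalSpace S]
    [IsTopologicalRing S] {Z : Type v} {e : Z → S} (hsum : HasSum e 1)
    (hsimple : ∀ z s, e z * s = 0 ∨ ∃ b, e z * s * b = e z) {N : Type w} [AddCommGroup N]
    [Module Sᵐᵒᵖ N] (hN : IsDiscreteRightModule S N) : IsSemisimpleModule Sᵐᵒᵖ N := by
  refine isSemisimpleModule_of_isSemisimpleModule_submodule'
    (p := fun i : N × Z => Submodule.span Sᵐᵒᵖ {op (e i.2) • i.1}) ?_ ?_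
  · rintro ⟨n, z⟩
    by_cases h0 : op (e z) • n = 0
    · have : Submodule.span Sᵐᵒᵖ {op (e z) • n} = ⊥ := by
        rw [h0, Submodule.span_zero_singleton]
      rw [this]
      have : Subsingleton (Submodule Sᵐᵒᵖ (⊥ : Submodule Sᵐᵒᵖ N)) :=
        (Submodule.subsingleton_iff Sᵐᵒᵖ).2 inferInstance
      exact { toComplementedLattice := Subsingleton.instComplementedLattice }
    · suffices IsSimpleModule Sᵐᵒᵖ (Submodule.span Sᵐᵒᵖ {op (e z) • n}) from inferInstance
      rw [isSimpleModule_iff_isAtom]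
      refine ⟨by simpa using h0, fun Q hQ => ?_⟩
      by_contra hQ0
      obtain ⟨m, hm, hm0⟩ := Q.exists_mem_ne_zero_of_ne_bot hQ0
      obtain ⟨c, rfl⟩ := Submodule.mem_span_singleton.1 (hQ.le hm)
      rcases hsimple z c.unop with h | ⟨b, hb⟩
      · refine hm0 ?_
        rw [← mul_smul, ← op_unop c, ← op_mul, h, op_zero, zero_smul]
      · refine hQ.not_ge ((Submodule.span_singleton_le_iff_mem _ _).2 ?_)
        have := Q.smul_mem (op b) hm
        rwa [← mul_smul, ← mul_smul, ← op_unop c, ← op_mul, ← op_mul, ← mul_assoc, hb] at this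
  · rw [eq_top_iff]
    intro n _
    -- The annihilator of `n` is open, so some finite partial sum of the `e z` already acts on `n`
    -- as 1.
    have h1 : ∀ᶠ s in 𝓝 (1 : S), op (s - 1) • n = 0 := by
      have h2 : IsOpen {s : S | op (s - 1) • n = 0} :=
        (hN n).preimage (continuous_id.sub continuous_const)
      exact h2.mem_nhds (by simp)
    obtain ⟨F, hF⟩ := (hsum.eventually h1).exists
    rw [op_sub, sub_smul, op_one, one_smul, sub_eq_zero] at hF
    rw [← hF, Finset.op_sum, Finset.sum_smul]
    exact sum_mem fun z _ => Submodule.mem_iSup_of_mem (n, z) (Submodule.mem_span_singleton_self _)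

theorem isTopologicallySemisimple_quotient_topologicalJacobson {R : Type u} [Ring R]
    [TopologicalSpace R] [IsCompleteRightLinear R] {Z : Type v} {e : Z → R}
    (he : OrthogonalIdempotents e)
    (hz : ZeroConvergent e) (hsum : HasSum e 1) (hl : ∀ z, IsLocalIdempotent (e z)) :
    IsTopologicallySemisimple (R ⧸ topologicalJacobsonIdeal R) where
  isCompleteRightLinear := by
    have := (topologicalJacobsonIdeal R).isTopologicalRing_quotient
    have := (topologicalJacobsonIdeal R).isLinearTopology_quotient
    have h1 : IsClosed ((topologicalJacobsonIdeal R).toAddSubgroup : Set R) :=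
      isClosed_topologicalJacobson R
    have h2 : T2Space (R ⧸ topologicalJacobsonIdeal R) :=
      inferInstanceAs (T2Space (R ⧸ (topologicalJacobsonIdeal R).toAddSubgroup))
    exact { complete := (isStronglyClosed_topologicalJacobson he hz hsum hl).complete }
  isSemisimpleModule N _ _ hN := by
    have := (topologicalJacobsonIdeal R).isTopologicalRing_quotient
    have hq : Continuous (Ideal.Quotient.mk (topologicalJacobsonIdeal R)) :=
      QuotientAddGroup.continuous_mk (N := (topologicalJacobsonIdeal R).toAddSubgroup)
    have hmap := hsum.map (Ideal.Quotient.mk (topologicalJacobsonIdeal R)) hq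
    rw [map_one] at hmap
    refine isSemisimpleModule_of_isDiscreteRightModule hmap (fun z s => ?_) hN
    obtain ⟨r, rfl⟩ := Ideal.Quotient.mk_surjective s
    by_cases h : r ∈ (hl z).rightIdeal
    · refine Or.inl ?_
      rw [Function.comp_apply, ← map_mul, Ideal.Quotient.eq_zero_iff_mem]
      exact (mem_topologicalJacobson_iff hsum hl).2 fun w => mul_mem_rightIdeal_of_mem he hl h w
    · obtain ⟨b, hb⟩ := (hl z).notMem_rightIdeal.1 h
      refine Or.inr ⟨Ideal.Quotient.mk _ b, ?_⟩
      rw [Function.comp_apply, ← map_mul, ← map_mul, hb]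

/-! ### Endomorphism rings with the finite topology. -/

namespace RightEnd

section

variable {A : Type v} [Ring A] {M : Type w} [AddCommGroup M] [Module A M]

theorem tendsto_nhds_iff {X : Type*} {f : X → RightEnd A M} {l : Filter X} {r : RightEnd A M} :
    Tendsto f l (𝓝 r) ↔ ∀ m, ∀ᶠ x in l, (f x).unop m = r.unop m := by
  let : TopologicalSpace M := ⊥
  have : DiscreteTopology M := ⟨rfl⟩
  rw [nhds_induced, tendsto_comap_iff, tendsto_pi_nhds]
  simp only [nhds_discrete, tendsto_pure, Function.comp_apply]

theorem eventually_apply_eq (r : RightEnd A M) (m : M) :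
    ∀ᶠ s in 𝓝 r, s.unop m = r.unop m :=
  tendsto_nhds_iff.1 tendsto_id m

instance : IsTopologicalRing (RightEnd A M) where
  continuous_add := continuous_iff_continuousAt.2 fun ⟨r, s⟩ => tendsto_nhds_iff.2 fun m => by
    rw [nhds_prod_eq]
    filter_upwards [(eventually_apply_eq r m).prod_mk (eventually_apply_eq s m)] with p hp
    simp [hp.1, hp.2]
  continuous_mul := continuous_iff_continuousAt.2 fun ⟨r, s⟩ => tendsto_nhds_iff.2 fun m => by
    rw [nhds_prod_eq]
    filter_upwards [(eventually_apply_eq r m).prod_mk (eventually_apply_eq s (r.unop m))] with p hp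
    simp [hp.1, hp.2]
  continuous_neg := continuous_iff_continuousAt.2 fun r => tendsto_nhds_iff.2 fun m => by
    filter_upwards [eventually_apply_eq r m] with p hp
    simp [hp]

instance : IsLinearTopology (RightEnd A M)ᵐᵒᵖ (RightEnd A M) where
  hasBasis_submodule' := by
    refine ⟨fun U => ⟨fun hU => ?_, fun ⟨N, hN, hNU⟩ => mem_of_superset hN hNU⟩⟩
    let : TopologicalSpace M := ⊥
    have : DiscreteTopology M := ⟨rfl⟩
    rw [nhds_induced, mem_comap, nhds_pi] at hU
    obtain ⟨V, hV, hVU⟩ := hU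
    obtain ⟨I, hI, t, ht, htV⟩ := Filter.mem_pi.1 hV
    refine ⟨{ carrier := {r | ∀ m ∈ I, r.unop m = 0}
              zero_mem' := fun m _ => rfl
              add_mem' := fun {r s} hr hs m hm => by simp [hr m hm, hs m hm]
              smul_mem' := fun c r hr m hm => by simp [hr m hm] }, ?_, fun r hr => ?_⟩
    · exact (eventually_all_finite hI).2 fun m _ => eventually_apply_eq 0 m
    · refine hVU (htV fun m hm => ?_)
      have h0 := mem_of_mem_nhds (ht m)
      have : r.unop m = 0 := hr m hm
      simpa [this] using h0

instance : T2Space (RightEnd A M) := by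
  let : TopologicalSpace M := ⊥
  have : DiscreteTopology M := ⟨rfl⟩
  refine T2Space.of_injective_continuous (f := fun (r : RightEnd A M) (m : M) => r.unop m)
    (fun r s h => unop_injective (LinearMap.ext (congrFun h))) continuous_induced_dom

end

section DirectSum

open DirectSum

variable {A : Type v} [Ring A] {Z : Type w} [DecidableEq Z] {M : Z → Type x}
  [∀ z, AddCommGroup (M z)] [∀ z, Module A (M z)]

variable (A M) in
/-- The idempotent of `End_A(⨁ z, M z)ᵒᵖ` projecting onto the summand `M z`. -/
def proj (z : Z) : RightEnd A (DirectSum Z M) :=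
  op (lof A Z M z ∘ₗ component A Z M z)

theorem proj_apply (z : Z) (m : DirectSum Z M) :
    (proj A M z).unop m = lof A Z M z (component A Z M z m) := rfl

theorem component_lof_of_ne {z w : Z} (h : w ≠ z) (m : M w) :
    component A Z M z (lof A Z M w m) = 0 := by
  rw [component.of, dif_neg h]

theorem orthogonalIdempotents_proj : OrthogonalIdempotents (proj A M) where
  idem z := unop_injective <| LinearMap.ext fun m => by
    simp [proj_apply, component.lof_self]
  ortho z w h := unop_injective <| LinearMap.ext fun m => by
    simp [proj_apply, component_lof_of_ne h]

variable (A M) in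
theorem hasSum_proj : HasSum (proj A M) 1 := by
  refine tendsto_nhds_iff.2 fun m => ?_
  simp only [Finset.unop_sum, LinearMap.sum_apply, unop_one, Module.End.one_apply]
  change ∀ᶠ s in atTop, _
  induction m using DirectSum.induction_on with
  | zero => simp
  | of z m =>
    filter_upwards [eventually_ge_atTop {z}] with F hF
    rw [Finset.sum_eq_single z]
    · rw [proj_apply, ← lof_eq_of A, component.lof_self]
    · intro w _ hw
      rw [proj_apply, ← lof_eq_of A, component_lof_of_ne hw.symm, map_zero]
    · exact fun h => absurd (hF (Finset.mem_singleton_self z)) h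
  | add m n hm hn =>
    filter_upwards [hm, hn] with F hm hn
    simp only [map_add, Finset.sum_add_distrib, hm, hn]

theorem isLocalIdempotent_proj {z : Z} (h : IsLocalRing (Module.End A (M z))) :
    IsLocalIdempotent (proj A M z) where
  idem := (orthogonalIdempotents_proj.idem z).eq
  ne_zero h0 := by
    refine one_ne_zero (α := Module.End A (M z)) (LinearMap.ext fun m => ?_)
    have := congrArg (fun r => component A Z M z (r.unop (lof A Z M z m))) h0
    simpa [proj_apply, component.lof_self] using this
  exists_mul_eq x := by
    have hφ := add_sub_cancel (matrixEntry x z z) 1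
    rcases IsLocalRing.isUnit_or_isUnit_of_add_one hφ with hu | hu
    -- Left inverses, because multiplication in `RightEnd` is composition reversed.
    · obtain ⟨c, hc⟩ := hu.exists_left_inv
      refine Or.inl ⟨op (lof A Z M z ∘ₗ c ∘ₗ component A Z M z), ?_⟩
      refine unop_injective (LinearMap.ext fun m => ?_)
      have := LinearMap.congr_fun hc (component A Z M z m)
      simp only [matrixEntry, Module.End.mul_apply, LinearMap.comp_apply,
        Module.End.one_apply] at this
      simp [proj_apply, component.lof_self, this]
    · obtain ⟨c, hc⟩ := hu.exists_left_inv
      refine Or.inr ⟨op (lof A Z M z ∘ₗ c ∘ₗ component A Z M z), ?_⟩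
      refine unop_injective (LinearMap.ext fun m => ?_)
      have := LinearMap.congr_fun hc (component A Z M z m)
      simp only [matrixEntry, Module.End.mul_apply, LinearMap.comp_apply,
        Module.End.one_apply, LinearMap.sub_apply, map_sub] at this
      simp only [unop_mul, unop_sub, Module.End.mul_apply, LinearMap.sub_apply, unop_op,
        proj_apply, LinearMap.comp_apply, component.lof_self, map_sub]
      rw [← map_sub, this]

theorem mem_topologicalJacobson_iff_matrixEntry (hM : ∀ z, IsLocalRing (Module.End A (M z)))
    (h : RightEnd A (DirectSum Z M)) :
    h ∈ topologicalJacobson (RightEnd A (DirectSum Z M)) ↔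
      ∀ w z : Z, ¬ Function.Bijective (matrixEntry h w z) := by
  have hl : ∀ z, IsLocalIdempotent (proj A M z) := fun z => isLocalIdempotent_proj (hM z)
  rw [mem_topologicalJacobson_iff (hasSum_proj A M) hl]
  refine forall_congr' fun w => ⟨fun hw z hb => ?_, fun hw => ?_⟩
  · let g := (LinearEquiv.ofBijective _ hb).symm
    refine hw (op (lof A Z M w ∘ₗ g.toLinearMap ∘ₗ component A Z M z)) ?_
    refine unop_injective (LinearMap.ext fun m => ?_)
    have : g (matrixEntry h w z (component A Z M w m)) = component A Z M w m :=
      (LinearEquiv.ofBijective _ hb).symm_apply_apply _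
    simp only [matrixEntry, LinearMap.comp_apply] at this
    simp [proj_apply, this]
  -- As the ideal is open, it suffices to test the single blocks `h * proj A M z`; a block outside
  -- it would make the entry `h w z` invertible, with inverse the entry of `b`.
  · refine mem_of_forall_mul_mem_left (I := (hl w).rightIdeal.toAddSubgroup) (hasSum_proj A M)
      (hl w).isOpen_rightIdeal fun z => ?_
    by_contra hz
    obtain ⟨b, hb⟩ := (hl w).notMem_rightIdeal.1 hz
    obtain ⟨h1, h2⟩ := (hl w).exists_inverse_of_mul_eq (hl z) hb
    refine hw z (Function.bijective_iff_has_inverse.2 ⟨matrixEntry b z w, fun m => ?_, fun m => ?_⟩)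
    · have := congrArg (fun r => component A Z M w (r.unop (lof A Z M w m))) h1
      simpa [proj_apply, component.lof_self, matrixEntry] using this
    · have := congrArg (fun r => component A Z M z (r.unop (lof A Z M z m))) h2
      simpa [proj_apply, component.lof_self, matrixEntry] using this

end DirectSum

end RightEnd

theorem theorem6p5 :
    (∀ (R : Type u) [Ring R] [TopologicalSpace R] [IsCompleteRightLinear R],
      IsTopologicallySemiperfect R →
        IsStronglyClosed (topologicalJacobsonIdeal R).toAddSubgroup ∧
        IsTopologicallySemisimple (R ⧸ topologicalJacobsonIdeal R)) ∧
    (∀ (A : Type v) [Ring A] (Z : Type w) [DecidableEq Z] (M : Z → Type x)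
      [∀ z, AddCommGroup (M z)] [∀ z, Module A (M z)],
      (∀ z, IsLocalRing (Module.End A (M z))) →
        ∀ h : RightEnd A (DirectSum Z M),
          h ∈ topologicalJacobson (RightEnd A (DirectSum Z M)) ↔
            ∀ w z : Z, ¬ Function.Bijective (matrixEntry h w z)) := by
  refine ⟨fun R _ _ _ ⟨Z, e, he, hz, hsum, hloc⟩ => ?_, fun A _ Z _ M _ _ hM h =>
    RightEnd.mem_topologicalJacobson_iff_matrixEntry hM h⟩
  have hl := fun z => isLocalIdempotent_of_isLocalRing_corner (he.idem z) (hloc z)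
  exact ⟨isStronglyClosed_topologicalJacobson he hz hsum hl,
    isTopologicallySemisimple_quotient_topologicalJacobson he hz hsum hl⟩
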